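/- **Definitions.** For a non-empty bounded set $S\subseteq\mathbb R^2$ let $\mathfrak l(S),\mathfrak r(S)$ be the infimum and supremum of the first coordinates of its points, $\mathfrak b(S),\mathfrak t(S)$ the infimum and supremum of the second coordinates, and $\mathrm{box}(S)=[\mathfrak l(S),\mathfrak r(S)]\times[\mathfrak b(S),\mathfrak t(S)]$. A *Pouna set* is a compact path-connected set $S\subseteq\mathbb R^2$ that is not an axis-parallel rectangle, i.e. not a product of two closed intervals (which may be degenerate). Its *territory* is $$\mathrm{Ter}(S)=\{(x,y)\in \mathrm{box}(S)\setminus S:\ \exists x'>x,\ (x',y)\in S\},$$ and $S$ is *strong* if $\mathrm{Ter}(S)\neq\varnothing$. For strong Pouna sets $A,B$ write $A\prec B$ if $\mathrm{box}(A)\subseteq \mathrm{Ter}(B)$, and $A\curvearrowright B$ if $A\ne B$, $A\cap B\neq\varnothing$, $\mathfrak l(B)\le\mathfrak l(A)<\mathfrak r(B)<\mathfrak r(A)$, $\mathfrak b(B)<\mathfrak b(A)<\mathfrak t(A)<\mathfrak t(B)$ and $\{(x,y)\in A: x=\mathfrak l(A)\}\subseteq \mathrm{Ter}(B)$. A *constrained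 family* is a non-empty finite family $\mathcal F$ of strong Pouna sets such that - (C1) for all $A,B\in\mathcal F$ with $A\neq B$ and $A\cap B\ne\varnothing$, either $A\curvearrowright B$ or $B\curvearrowright A$; - (C2) for all $A,B\in\mathcal F$ with $A\cap B=\varnothing$ and $A\cap \mathrm{Ter}(B)\neq\varnothing$, we have $A\prec B$; - (C3) for all $A,B\in\mathcal F$ with $A\ne B$ and $A\cap B\neq\varnothing$, there is no $C\in\mathcal F$ with $C\subseteq \mathrm{Ter}(A)\cap \mathrm{Ter}(B)$; - (C4) there are no $A,B,C\in\mathcal F$ with $A\prec B$, $A\curvearrowright C$ and $B\curvearrowright C$; - (C5) at most two distinct elements of $\mathcal F$ can be pairwise intersecting. The *oriented intersection graph* of $\mathcal F$ has vertex set $\mathcal F$ and an arc from $A$ to $B$ whenever $A\curvearrowright B$. An *oriented constrained graph* is an oriented graph isomorphic to the oriented intersection graph of a constrained family. A *Burling set* is a triple $(S,\prec,\curvearrowright)$ where $S$ is a non-empty set, $\prec$ is a strict partial order on $S$, $\curvearrowright$ is a binary relation on $S$ without directed cycles (of any length $\geq 1$), and for all $x,y,z\in S$: - (A1) if $x\prec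 y$, $x\prec z$ and $y\neq z$, then $y\prec z$ or $z\prec y$; - (A2) if $x\curvearrowright y$, $x\curvearrowright z$ and $y\ne z$, then $y\prec z$ or $z\prec y$; - (A3) if $x\curvearrowright y$ and $x\prec z$, then $y\prec z$; - (A4) if $x\curvearrowright y$ and $y\prec z$, then $x\curvearrowright z$ or $x\prec z$. An *oriented abstract Burling graph* is an oriented graph $G$ for which some strict partial order $\prec$ on $V(G)$ makes $(V(G),\prec,A(G))$ a Burling set. The *oriented Burling sequence* $(G_k,\mathcal S_k)_{k\ge 1}$ consists of oriented graphs $G_k$ with sets $\mathcal S_k$ of subsets of $V(G_k)$. $G_1$ has a single vertex and $\mathcal S_1=\{V(G_1)\}$. $G_{k+1}$ is obtained from a (base) copy of $G_k$ by adding, for each $S\in\mathcal S_k$, a new disjoint copy $G_k^S$ of $G_k$ and, for all $S,Q\in\mathcal S_k$, a new vertex $v_{S,Q}$ with an arc to each vertex of $Q^S$ (the copy of $Q$ in $G_k^S$) and no other arcs. $\mathcal S_{k+1}$ consists of all the sets $S\cup Q^S$ and $S\cup\{v_{S,Q}\}$ with $S,Q\in\mathcal S_k$, where $S$ is taken in the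 base copy. An *oriented Burling graph* is an oriented graph isomorphic to an induced subgraph of some $G_k$. A *Burling graph* is a (non-oriented) graph isomorphic to an induced subgraph of the underlying graph of some $G_k$. **Theorem.** For every constrained family $\mathcal F$, the triple $(\mathcal F,\prec,\curvearrowright)$ is a Burling set. Every oriented constrained graph is an oriented abstract Burling graph, and therefore a Burling graph: it is an oriented Burling graph, and its underlying graph is a Burling graph. -/

import Mathlib

/-! ### Bounding boxes of plane sets -/

noncomputable section

/-- The infimum of the first coordinates of the points of `S`. -/
def leftEnd (S : Set (ℝ × ℝ)) : ℝ := sInf (Prod.fst '' S)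

/-- The supremum of the first coordinates of the points of `S`. -/
def rightEnd (S : Set (ℝ × ℝ)) : ℝ := sSup (Prod.fst '' S)

/-- The infimum of the second coordinates of the points of `S`. -/
def bottomEnd (S : Set (ℝ × ℝ)) : ℝ := sInf (Prod.snd '' S)

/-- The supremum of the second coordinates of the points of `S`. -/
def topEnd (S : Set (ℝ × ℝ)) : ℝ := sSup (Prod.snd '' S)

end

/-- The bounding box of a (non-empty, bounded) plane set: the smallest closed axis-parallel rectangle
containing it. -/
def boundingBox (S : Set (ℝ × ℝ)) : Set (ℝ × ℝ) :=
  Set.Icc (leftEnd S) (rightEnd S) ×ˢ Set.Icc (bottomEnd S) (topEnd S)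

/-- Axis-parallel rectangles: products of two closed bounded intervals. The intervals may be empty or
reduced to one point, so the empty set, points and axis-parallel segments are included. (Unbounded
closed intervals play no role, since only compact sets are compared with rectangles.) -/
def IsAxisParallelRectangle (S : Set (ℝ × ℝ)) : Prop :=
  ∃ a b c d : ℝ, S = Set.Icc a b ×ˢ Set.Icc c d

/-! ### Pouna sets, territories, and the relations `≺` and `↷` -/

/-- A Pouna set: compact, path-connected, and not an axis-parallel rectangle. -/
structure IsPounaSet (S : Set (ℝ × ℝ)) : Prop where
  isPathConnected : IsPathConnected S
  isCompact : IsCompact S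
  not_rectangle : ¬ IsAxisParallelRectangle S

/-- The territory of `S`: the points of the bounding box outside `S` which have a point of `S`
strictly to their right on the same horizontal line. -/
def territory (S : Set (ℝ × ℝ)) : Set (ℝ × ℝ) :=
  {p | p ∈ boundingBox S \ S ∧ ∃ x' : ℝ, p.1 < x' ∧ (x', p.2) ∈ S}

/-- A strong Pouna set: one with non-empty territory. -/
def IsStrongPounaSet (S : Set (ℝ × ℝ)) : Prop :=
  IsPounaSet S ∧ (territory S).Nonempty

/-- `A ≺ B`: the bounding box of `A` lies in the territory of `B`. -/
def PounaPrec (A B : Set (ℝ × ℝ)) : Prop := boundingBox A ⊆ territory B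

/-- `A ↷ B`. -/
structure PounaArc (A B : Set (ℝ × ℝ)) : Prop where
  ne : A ≠ B
  inter_nonempty : (A ∩ B).Nonempty
  left_le : leftEnd B ≤ leftEnd A
  left_lt_right : leftEnd A < rightEnd B
  right_lt : rightEnd B < rightEnd A
  bottom_lt : bottomEnd B < bottomEnd A
  bottom_lt_top : bottomEnd A < topEnd A
  top_lt : topEnd A < topEnd B
  left_side_subset : {p | p ∈ A ∧ p.1 = leftEnd A} ⊆ territory B

/-- A non-empty finite family of strong Pouna sets satisfying the five constraints. -/
structure IsConstrainedFamily (F : Set (Set (ℝ × ℝ))) : Prop where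
  nonempty : F.Nonempty
  finite : F.Finite
  strongPouna : ∀ A ∈ F, IsStrongPounaSet A
  c1 : ∀ A ∈ F, ∀ B ∈ F, A ≠ B → (A ∩ B).Nonempty → PounaArc A B ∨ PounaArc B A
  c2 : ∀ A ∈ F, ∀ B ∈ F, A ∩ B = ∅ → (A ∩ territory B).Nonempty → PounaPrec A B
  c3 : ∀ A ∈ F, ∀ B ∈ F, A ≠ B → (A ∩ B).Nonempty →
    ¬ ∃ C ∈ F, C ⊆ territory A ∩ territory B
  c4 : ¬ ∃ A ∈ F, ∃ B ∈ F, ∃ C ∈ F, PounaPrec A B ∧ PounaArc A C ∧ PounaArc B C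
  c5 : ∀ K ⊆ F, K.Pairwise (fun A B => (A ∩ B).Nonempty) → K.encard ≤ 2

/-- The oriented intersection graph of a family `F`: vertex set `F`, arcs `A ↷ B`. -/
def orientedIntersectionGraph (F : Set (Set (ℝ × ℝ))) : Digraph F where
  Adj A B := PounaArc A.1 B.1

/-- An oriented constrained graph: a digraph isomorphic to the oriented intersection graph of a
non-empty finite family of strong Pouna sets satisfying the five constraints. (Such a digraph has
neither loops nor 2-cycles, because `A ↷ B` gives `rightEnd B < rightEnd A`.) -/
def IsOrientedConstrainedGraph {V : Type*} (G : Digraph V) : Prop :=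
  ∃ F : Set (Set (ℝ × ℝ)), IsConstrainedFamily F ∧
    Nonempty (G.Adj ≃r (orientedIntersectionGraph F).Adj)

/-! ### Burling sets and abstract Burling graphs -/

/-- `(S, prec, arc)` is a Burling set. In the first two axioms `y` and `z` are distinct. -/
structure IsBurlingSet {S : Type*} (prec arc : S → S → Prop) : Prop where
  nonempty : Nonempty S
  prec_irrefl : ∀ x, ¬ prec x x
  prec_trans : ∀ x y z, prec x y → prec y z → prec x z
  /-- No directed cycles (of any positive length, so in particular no loops). -/
  arc_acyclic : ∀ x, ¬ Relation.TransGen arc x x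
  a1 : ∀ x y z, prec x y → prec x z → y ≠ z → prec y z ∨ prec z y
  a2 : ∀ x y z, arc x y → arc x z → y ≠ z → prec y z ∨ prec z y
  a3 : ∀ x y z, arc x y → prec x z → prec y z
  a4 : ∀ x y z, arc x y → prec y z → arc x z ∨ prec x z

/-- An oriented abstract Burling graph: some strict partial order on the vertices makes the vertex
set, with that order and the arc relation, a Burling set. (Loops and 2-cycles are excluded by the
acyclicity of the arc relation.) -/
def IsOrientedAbstractBurlingGraph {V : Type*} (G : Digraph V) : Prop :=
  ∃ prec : V → V → Prop, IsBurlingSet prec G.Adj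

/-! ### The Burling sequence and Burling graphs -/

/-- A digraph together with a family of vertex sets. -/
structure GraphWithSets where
  V : Type
  graph : Digraph V
  sets : Set (Set V)

/-- Vertices of the graph following `X`: those of a base copy of `X`, those of one further copy of
`X` for each set `S` of `X`, and a new vertex for each pair `(S, Q)` of sets of `X`. -/
inductive NextVertex (X : GraphWithSets) : Type
  | base (x : X.V) : NextVertex X
  | copy (S : X.sets) (x : X.V) : NextVertex X
  | new (S Q : X.sets) : NextVertex X

/-- Arcs of the graph following `X`: those of all the copies, and an arc from the new vertex `(S, Q)`
to each vertex of `Q` in the copy of `X` that belongs to `S`. -/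
inductive NextArc (X : GraphWithSets) : NextVertex X → NextVertex X → Prop
  | base {x y : X.V} (h : X.graph.Adj x y) :
      NextArc X (NextVertex.base x) (NextVertex.base y)
  | copy (S : X.sets) {x y : X.V} (h : X.graph.Adj x y) :
      NextArc X (NextVertex.copy S x) (NextVertex.copy S y)
  | new (S Q : X.sets) {y : X.V} (h : y ∈ Q.1) :
      NextArc X (NextVertex.new S Q) (NextVertex.copy S y)

/-- One step of Burling's construction. For each pair `(S, Q)` of sets of `X`, the result has the two
sets "`S` in the base copy, together with `Q` in the copy belonging to `S`" and "`S` in the base copy,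
together with the new vertex `(S, Q)`". -/
def GraphWithSets.next (X : GraphWithSets) : GraphWithSets where
  V := NextVertex X
  graph := { Adj := NextArc X }
  sets := {T | ∃ S Q : X.sets,
    T = NextVertex.base '' S.1 ∪ NextVertex.copy S '' Q.1 ∨
    T = NextVertex.base '' S.1 ∪ {NextVertex.new S Q}}

/-- The Burling sequence (oriented, with its stable sets), starting from a one-vertex graph whose only
distinguished set consists of that vertex. -/
def burlingSequence : ℕ → GraphWithSets
  | 0 => { V := Unit, graph := { Adj := fun _ _ => False }, sets := {Set.univ} }
  | k + 1 => (burlingSequence k).next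

/-- An oriented Burling graph: an induced subdigraph of a digraph in the oriented Burling sequence. -/
def IsOrientedBurlingGraph {V : Type*} (G : Digraph V) : Prop :=
  ∃ k : ℕ, Nonempty (G.Adj ↪r (burlingSequence k).graph.Adj)

/-- A Burling graph: an induced subgraph of a graph in the Burling sequence. Here
`toSimpleGraphInclusive` is the underlying (non-oriented) graph of a digraph. -/
def IsBurlingGraph {V : Type*} (G : SimpleGraph V) : Prop :=
  ∃ k : ℕ, Nonempty (G ↪g (burlingSequence k).graph.toSimpleGraphInclusive)

/-! ### Pouna sets -/

/-! The Burling axioms are geometric. If the territories of two disjoint members share a point, both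
members have points to its right on one horizontal line, and the nearer of these lies in the
territory of the other set; by (C2) the members are comparable (`prec_or_prec`). This yields (A1)
and (A2), where (C3) and (C5) supply disjointness. For (A3) and (A4), a point of `A ∩ B` lies in the
territory of `C`, and the unwanted intersections contradict (C4) or the inclusion of bounding boxes.

Any finite Burling set then embeds in the Burling sequence, by induction on its size
(`exists_realizes`). The induction also makes every upward closed chain a trace of a distinguished
set: the out-neighbours of a vertex `v` to be added form such a chain. With `v` maximal and without
in-neighbours, no arc joins the elements below `v` to the others; `next_insert` adds `v` to the
elements that are neither `v` nor below it, and `next_union` hangs those below `v` under `{v}`. -/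

theorem IsCompact.subset_boundingBox {S : Set (ℝ × ℝ)} (hS : IsCompact S) :
    S ⊆ boundingBox S := by
  intro p hp
  have h1 := hS.image continuous_fst
  have h2 := hS.image continuous_snd
  exact ⟨⟨csInf_le h1.bddBelow ⟨p, hp, rfl⟩, le_csSup h1.bddAbove ⟨p, hp, rfl⟩⟩,
    csInf_le h2.bddBelow ⟨p, hp, rfl⟩, le_csSup h2.bddAbove ⟨p, hp, rfl⟩⟩

theorem territory_subset_boundingBox (S : Set (ℝ × ℝ)) : territory S ⊆ boundingBox S :=
  fun _ hp => hp.1.1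

theorem notMem_of_mem_territory {S : Set (ℝ × ℝ)} {p : ℝ × ℝ} (hp : p ∈ territory S) : p ∉ S :=
  hp.1.2

/-- The corners of the bounding box of a non-empty compact set belong to it. -/
theorem IsCompact.corners_mem_boundingBox {S : Set (ℝ × ℝ)} (hS : IsCompact S)
    (hne : S.Nonempty) :
    (leftEnd S, bottomEnd S) ∈ boundingBox S ∧ (rightEnd S, topEnd S) ∈ boundingBox S := by
  obtain ⟨p, hp⟩ := hne
  obtain ⟨⟨h1, h2⟩, h3, h4⟩ := hS.subset_boundingBox hp
  exact ⟨⟨⟨le_rfl, h1.trans h2⟩, le_rfl, h3.trans h4⟩, ⟨h1.trans h2, le_rfl⟩, h3.trans h4, le_rfl⟩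

/-- A non-empty compact set has a point of smallest first coordinate. -/
theorem IsCompact.exists_fst_eq_leftEnd {S : Set (ℝ × ℝ)} (hS : IsCompact S)
    (hne : S.Nonempty) : ∃ p ∈ S, p.1 = leftEnd S :=
  (hS.image continuous_fst).sInf_mem (hne.image _)

theorem IsStrongPounaSet.nonempty {S : Set (ℝ × ℝ)} (h : IsStrongPounaSet S) : S.Nonempty :=
  h.1.isPathConnected.nonempty

theorem IsStrongPounaSet.isCompact {S : Set (ℝ × ℝ)} (h : IsStrongPounaSet S) : IsCompact S :=
  h.1.isCompact

theorem PounaPrec.boundingBox_subset {A B : Set (ℝ × ℝ)} (h : PounaPrec A B) :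
    boundingBox A ⊆ boundingBox B :=
  h.trans (territory_subset_boundingBox B)

theorem PounaPrec.trans {A B C : Set (ℝ × ℝ)} (hAB : PounaPrec A B) (hBC : PounaPrec B C) :
    PounaPrec A C :=
  hAB.boundingBox_subset.trans hBC

theorem PounaPrec.subset_territory {A B : Set (ℝ × ℝ)} (hA : IsStrongPounaSet A)
    (h : PounaPrec A B) : A ⊆ territory B :=
  hA.isCompact.subset_boundingBox.trans h

theorem PounaPrec.inter_eq_empty {A B : Set (ℝ × ℝ)} (hA : IsStrongPounaSet A)
    (h : PounaPrec A B) : A ∩ B = ∅ :=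
  Set.eq_empty_of_forall_notMem fun _ hp =>
    notMem_of_mem_territory (h.subset_territory hA hp.1) hp.2

/-- If the territories of two disjoint compact sets share a point, then one of the sets meets the
territory of the other. -/
theorem inter_territory_nonempty_or {A B : Set (ℝ × ℝ)} (hA : IsCompact A) (hB : IsCompact B)
    (hAB : A ∩ B = ∅) {p : ℝ × ℝ} (hpA : p ∈ territory A) (hpB : p ∈ territory B) :
    (A ∩ territory B).Nonempty ∨ (B ∩ territory A).Nonempty := by
  have key : ∀ {A B : Set (ℝ × ℝ)}, IsCompact B → A ∩ B = ∅ → p ∈ territory B →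
      ∀ {a b : ℝ}, p.1 < a → a < b → (a, p.2) ∈ A → (b, p.2) ∈ B →
      (A ∩ territory B).Nonempty := by
    intro A B hB hAB hp a b hpa hab ha hb
    refine ⟨(a, p.2), ha, ⟨⟨⟨hp.1.1.1.1.trans hpa.le, ?_⟩, hp.1.1.2⟩, fun h => ?_⟩, b, hab, hb⟩
    · exact hab.le.trans (hB.subset_boundingBox hb).1.2
    · exact Set.eq_empty_iff_forall_notMem.1 hAB _ ⟨ha, h⟩
  obtain ⟨a, hpa, ha⟩ := hpA.2
  obtain ⟨b, hpb, hb⟩ := hpB.2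
  rcases lt_trichotomy a b with h | rfl | h
  · exact Or.inl (key hB hAB hpB hpa h ha hb)
  · exact absurd ⟨ha, hb⟩ (Set.eq_empty_iff_forall_notMem.1 hAB _)
  · exact Or.inr (key hA (Set.inter_comm A B ▸ hAB) hpA hpb h hb ha)

/-! ### The Burling axioms for constrained families. -/

namespace IsConstrainedFamily

variable {F : Set (Set (ℝ × ℝ))} {A B C : Set (ℝ × ℝ)}

/-- Two disjoint members whose territories share a point are comparable. -/
theorem prec_or_prec (hF : IsConstrainedFamily F) (hA : A ∈ F) (hB : B ∈ F) (hAB : A ∩ B = ∅)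
    {p : ℝ × ℝ} (hpA : p ∈ territory A) (hpB : p ∈ territory B) :
    PounaPrec A B ∨ PounaPrec B A := by
  rcases inter_territory_nonempty_or (hF.strongPouna A hA).isCompact
    (hF.strongPouna B hB).isCompact hAB hpA hpB with h | h
  · exact Or.inl (hF.c2 A hA B hB hAB h)
  · exact Or.inr (hF.c2 B hB A hA (Set.inter_comm A B ▸ hAB) h)

/-- Axiom (A1): `A` lies in both territories, so (C3) forces `B` and `C` to be disjoint, and any
point of `A` is common to the two territories. -/
theorem prec_or_prec_of_common_prec (hF : IsConstrainedFamily F) (hA : A ∈ F) (hB : B ∈ F)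
    (hC : C ∈ F) (hAB : PounaPrec A B) (hAC : PounaPrec A C) (hne : B ≠ C) :
    PounaPrec B C ∨ PounaPrec C B := by
  have hA' := hF.strongPouna A hA
  have hBC : B ∩ C = ∅ := by
    by_contra h
    exact hF.c3 B hB C hC hne (Set.nonempty_iff_ne_empty.2 h)
      ⟨A, hA, Set.subset_inter (hAB.subset_territory hA') (hAC.subset_territory hA')⟩
  obtain ⟨p, hp⟩ := hA'.nonempty
  exact hF.prec_or_prec hB hC hBC (hAB.subset_territory hA' hp) (hAC.subset_territory hA' hp)

theorem inter_eq_empty_of_common_arc (hF : IsConstrainedFamily F) (hA : A ∈ F) (hB : B ∈ F)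
    (hC : C ∈ F) (hAB : PounaArc A B) (hAC : PounaArc A C) (hne : B ≠ C) : B ∩ C = ∅ := by
  by_contra h
  have hBC := Set.nonempty_iff_ne_empty.2 h
  have hK : ({A, B, C} : Set (Set (ℝ × ℝ))).Pairwise (fun A B => (A ∩ B).Nonempty) := by
    have : Std.Symm fun A B : Set (ℝ × ℝ) => (A ∩ B).Nonempty :=
      ⟨fun _ _ ⟨p, hp⟩ => ⟨p, hp.2, hp.1⟩⟩
    rw [Set.pairwise_insert_of_symm, Set.pairwise_pair_of_symm]
    refine ⟨fun _ => hBC, ?_⟩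
    rintro D (rfl | rfl) _
    exacts [hAB.inter_nonempty, hAC.inter_nonempty]
  have hcard := hF.c5 {A, B, C} (by rintro D (rfl | rfl | rfl) <;> assumption) hK
  rw [Set.encard_eq_three.2 ⟨A, B, C, hAB.ne, hAC.ne, hne, rfl⟩] at hcard
  exact absurd hcard (by decide)

/-- Axiom (A2): a leftmost point of `A` lies in both territories. -/
theorem prec_or_prec_of_common_arc (hF : IsConstrainedFamily F) (hA : A ∈ F) (hB : B ∈ F)
    (hC : C ∈ F) (hAB : PounaArc A B) (hAC : PounaArc A C) (hne : B ≠ C) :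
    PounaPrec B C ∨ PounaPrec C B := by
  have hA' := hF.strongPouna A hA
  obtain ⟨p, hp⟩ := hA'.isCompact.exists_fst_eq_leftEnd hA'.nonempty
  exact hF.prec_or_prec hB hC (hF.inter_eq_empty_of_common_arc hA hB hC hAB hAC hne)
    (hAB.left_side_subset hp) (hAC.left_side_subset hp)

theorem prec_of_arc_of_prec (hF : IsConstrainedFamily F) (hA : A ∈ F) (hB : B ∈ F)
    (hC : C ∈ F) (hAB : PounaArc A B) (hAC : PounaPrec A C) : PounaPrec B C := by
  have hA' := hF.strongPouna A hA
  obtain ⟨p, hpA, hpB⟩ := hAB.inter_nonempty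
  have hpC := hAC.subset_territory hA' hpA
  have hne : B ≠ C := by
    rintro rfl
    exact notMem_of_mem_territory hpC hpB
  refine hF.c2 B hB C hC ?_ ⟨p, hpB, hpC⟩
  by_contra h
  rcases hF.c1 B hB C hC hne (Set.nonempty_iff_ne_empty.2 h) with hBC | hCB
  -- `B ↷ C` would put the right end of `C` to the left of that of `A`, although the box of `A` lies
  -- in the box of `C`.
  · have h1 := (hAC.boundingBox_subset
      (hA'.isCompact.corners_mem_boundingBox hA'.nonempty).2).1.2
    exact absurd (hBC.right_lt.trans hAB.right_lt) (not_lt.2 h1)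
  · exact hF.c4 ⟨A, hA, C, hC, B, hB, hAC, hAB, hCB⟩

theorem arc_or_prec_of_arc_of_prec (hF : IsConstrainedFamily F) (hA : A ∈ F) (hB : B ∈ F)
    (hC : C ∈ F) (hAB : PounaArc A B) (hBC : PounaPrec B C) : PounaArc A C ∨ PounaPrec A C := by
  have hB' := hF.strongPouna B hB
  obtain ⟨p, hpA, hpB⟩ := hAB.inter_nonempty
  have hpC := hBC.subset_territory hB' hpB
  have hne : A ≠ C := by
    rintro rfl
    exact notMem_of_mem_territory hpC hpA
  by_cases hAC : A ∩ C = ∅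
  · exact Or.inr (hF.c2 A hA C hC hAC ⟨p, hpA, hpC⟩)
  rcases hF.c1 A hA C hC hne (Set.nonempty_iff_ne_empty.2 hAC) with h | h
  · exact Or.inl h
  -- `C ↷ A` would put the bottom of `B` below that of `C`, although the box of `B` lies in the box
  -- of `C`.
  · have h1 := (hBC.boundingBox_subset
      (hB'.isCompact.corners_mem_boundingBox hB'.nonempty).1).2.1
    exact absurd (hAB.bottom_lt.trans h.bottom_lt) (not_lt.2 h1)

theorem isBurlingSet (hF : IsConstrainedFamily F) :
    IsBurlingSet (fun A B : F => PounaPrec A.1 B.1) (fun A B : F => PounaArc A.1 B.1) where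
  nonempty := hF.nonempty.to_subtype
  prec_irrefl A h := by
    have h1 := h.inter_eq_empty (hF.strongPouna A.1 A.2)
    rw [Set.inter_self] at h1
    exact (hF.strongPouna A.1 A.2).nonempty.ne_empty h1
  prec_trans _ _ _ h1 h2 := h1.trans h2
  arc_acyclic A h := by
    -- Right ends strictly decrease along arcs.
    have key : ∀ B : F, Relation.TransGen (fun A B : F => PounaArc A.1 B.1) A B →
        rightEnd B.1 < rightEnd A.1 := by
      intro B hB
      induction hB with
      | single h => exact h.right_lt
      | tail _ h ih => exact h.right_lt.trans ih
    exact lt_irrefl _ (key A h)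
  a1 A B C h1 h2 hne :=
    hF.prec_or_prec_of_common_prec A.2 B.2 C.2 h1 h2 (Subtype.coe_injective.ne hne)
  a2 A B C h1 h2 hne :=
    hF.prec_or_prec_of_common_arc A.2 B.2 C.2 h1 h2 (Subtype.coe_injective.ne hne)
  a3 A B C h1 h2 := hF.prec_of_arc_of_prec A.2 B.2 C.2 h1 h2
  a4 A B C h1 h2 := hF.arc_or_prec_of_arc_of_prec A.2 B.2 C.2 h1 h2

end IsConstrainedFamily

/-! ### Realizing finite Burling sets in the Burling sequence -/

/-- `X` contains a copy of the digraph induced by `arc` on `A`, in which every set of `𝒯` is the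
trace on `A` of one of the sets of `X`. -/
def GraphWithSets.Realizes {S : Type*} (X : GraphWithSets) (arc : S → S → Prop) (A : Set S)
    (𝒯 : Set (Set S)) : Prop :=
  ∃ f : S → X.V, Set.InjOn f A ∧ (∀ x ∈ A, ∀ y ∈ A, X.graph.Adj (f x) (f y) ↔ arc x y) ∧
    ∀ T ∈ 𝒯, ∃ T' ∈ X.sets, ∀ x ∈ A, f x ∈ T' ↔ x ∈ T

section NextVertex

variable {X : GraphWithSets}

theorem nextArc_base_base {x y : X.V} :
    NextArc X (.base x) (.base y) ↔ X.graph.Adj x y :=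
  ⟨fun h => by cases h; assumption, .base⟩

theorem nextArc_copy_copy {S : X.sets} {x y : X.V} :
    NextArc X (.copy S x) (.copy S y) ↔ X.graph.Adj x y :=
  ⟨fun h => by cases h; assumption, .copy S⟩

theorem nextArc_new_copy {S Q : X.sets} {y : X.V} :
    NextArc X (.new S Q) (.copy S y) ↔ y ∈ Q.1 :=
  ⟨fun h => by cases h; assumption, .new S Q⟩

theorem not_nextArc_new {S Q : X.sets} {a : NextVertex X} : ¬ NextArc X a (.new S Q) :=
  fun h => by cases h

theorem not_nextArc_base_copy {S : X.sets} {x y : X.V} :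
    ¬ NextArc X (.base x) (.copy S y) :=
  fun h => by cases h

theorem not_nextArc_copy_base {S : X.sets} {x y : X.V} :
    ¬ NextArc X (.copy S x) (.base y) :=
  fun h => by cases h

variable {S T : Set X.V} {P Q : X.sets} {x : X.V}

theorem base_mem_union_copy :
    .base x ∈ NextVertex.base '' S ∪ NextVertex.copy Q '' T ↔ x ∈ S := by
  simp

theorem copy_mem_union_copy :
    .copy Q x ∈ NextVertex.base '' S ∪ NextVertex.copy Q '' T ↔ x ∈ T := by
  simp

theorem new_notMem_union_copy :
    .new P P ∉ NextVertex.base '' S ∪ NextVertex.copy Q '' T := by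
  simp

theorem base_mem_union_new : .base x ∈ NextVertex.base '' S ∪ {.new P Q} ↔ x ∈ S := by
  simp

theorem copy_notMem_union_new {R : X.sets} :
    .copy R x ∉ NextVertex.base '' S ∪ {.new P Q} := by
  simp

end NextVertex

/-! ### Realizations under one step of the Burling sequence. -/

namespace GraphWithSets.Realizes

variable {S : Type*} {X : GraphWithSets} {arc : S → S → Prop} {A : Set S} {𝒯 : Set (Set S)}

theorem next (h : X.Realizes arc A 𝒯) : X.next.Realizes arc A 𝒯 := by
  obtain ⟨f, hinj, harc, hset⟩ := h
  refine ⟨fun x => .base (f x), fun x hx y hy h => hinj hx hy (NextVertex.base.inj h),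
    fun x hx y hy => nextArc_base_base.trans (harc x hx y hy), fun T hT => ?_⟩
  obtain ⟨T', hT', hiff⟩ := hset T hT
  refine ⟨_, ⟨⟨T', hT'⟩, ⟨T', hT'⟩, Or.inr rfl⟩, fun x hx => ?_⟩
  exact base_mem_union_new.trans (hiff x hx)

/-- Adding a vertex `v` with arcs exactly to the elements of a set `N` of the system, and the set
`{v}` to the system. -/
theorem next_insert (h : X.Realizes arc A 𝒯) {v : S} (hv : v ∉ A) {N : Set S} (hN : N ∈ 𝒯)
    (hout : ∀ x ∈ A, arc v x ↔ x ∈ N) (hin : ∀ x ∈ insert v A, ¬ arc x v) :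
    X.next.Realizes arc (insert v A) (insert {v} {T ∈ 𝒯 | v ∉ T}) := by
  classical
  obtain ⟨f, hinj, harc, hset⟩ := h
  obtain ⟨N', hN', hNiff⟩ := hset N hN
  -- `N'` plays two roles: `A` goes into the copy belonging to it, and `v` becomes the new vertex
  -- whose arcs go to `N'` in that copy. Only the second role matters; the copy could belong to any
  -- set.
  let Q : X.sets := ⟨N', hN'⟩
  let g : S → NextVertex X := fun x => if x = v then .new Q Q else .copy Q (f x)
  have hgv : g v = .new Q Q := if_pos rfl
  have hgA : ∀ x ∈ A, g x = .copy Q (f x) := fun x hx => if_neg (ne_of_mem_of_not_mem hx hv)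
  refine ⟨g, ?_, ?_, ?_⟩
  · rintro x (rfl | hx) y (rfl | hy) hxy
    · rfl
    · rw [hgv, hgA y hy] at hxy
      cases hxy
    · rw [hgv, hgA x hx] at hxy
      cases hxy
    · rw [hgA x hx, hgA y hy] at hxy
      exact hinj hx hy (NextVertex.copy.inj hxy).2
  · rintro x hx y (rfl | hy)
    · rw [hgv]
      exact iff_of_false not_nextArc_new (hin x hx)
    · rw [hgA y hy]
      rcases hx with rfl | hx
      · rw [hgv, hout y hy, ← hNiff y hy]
        exact nextArc_new_copy
      · rw [hgA x hx, ← harc x hx y hy]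
        exact nextArc_copy_copy
  · rintro T (rfl | ⟨hT, hvT⟩)
    · refine ⟨_, ⟨Q, Q, Or.inr rfl⟩, ?_⟩
      rintro x (rfl | hx)
      · rw [hgv]
        exact iff_of_true (Or.inr rfl) rfl
      · rw [hgA x hx]
        exact iff_of_false copy_notMem_union_new (ne_of_mem_of_not_mem hx hv)
    · obtain ⟨T', hT', hiff⟩ := hset T hT
      refine ⟨_, ⟨Q, ⟨T', hT'⟩, Or.inl rfl⟩, ?_⟩
      rintro x (rfl | hx)
      · rw [hgv]
        exact iff_of_false new_notMem_union_copy hvT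
      · rw [hgA x hx]
        exact copy_mem_union_copy.trans (hiff x hx)

/-- Hanging a set `D`, without arcs from or to `A`, below a set `P` of the system on `A`. -/
theorem next_union (h : X.Realizes arc A 𝒯) {D : Set S} {𝒟 : Set (Set S)}
    (hD : X.Realizes arc D 𝒟) (hAD : Disjoint A D)
    (harcAD : ∀ x ∈ A, ∀ y ∈ D, ¬ arc x y ∧ ¬ arc y x) {P : Set S} (hP : P ∈ 𝒯) :
    X.next.Realizes arc (A ∪ D)
      {T | (T ∈ 𝒯 ∧ Disjoint T D) ∨ (T ∩ A = P ∩ A ∧ ∃ T₁ ∈ 𝒟, T ∩ D = T₁ ∩ D)} := by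
  classical
  obtain ⟨f, hinj, harc, hset⟩ := h
  obtain ⟨f', hinj', harc', hset'⟩ := hD
  obtain ⟨P', hP', hPiff⟩ := hset P hP
  -- `A` stays in the base and `D` goes into the copy belonging to `P'`, so the sets that meet this
  -- copy have trace `P` on `A`.
  let Q : X.sets := ⟨P', hP'⟩
  let g : S → NextVertex X := fun x => if x ∈ A then .base (f x) else .copy Q (f' x)
  have hgA : ∀ x ∈ A, g x = .base (f x) := fun x hx => if_pos hx
  have hgD : ∀ x ∈ D, g x = .copy Q (f' x) := fun x hx => if_neg (hAD.notMem_of_mem_right hx)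
  refine ⟨g, ?_, ?_, ?_⟩
  · rintro x (hx | hx) y (hy | hy) hxy
    · rw [hgA x hx, hgA y hy] at hxy
      exact hinj hx hy (NextVertex.base.inj hxy)
    · rw [hgA x hx, hgD y hy] at hxy
      cases hxy
    · rw [hgD x hx, hgA y hy] at hxy
      cases hxy
    · rw [hgD x hx, hgD y hy] at hxy
      exact hinj' hx hy (NextVertex.copy.inj hxy).2
  · rintro x (hx | hx) y (hy | hy)
    · rw [hgA x hx, hgA y hy, ← harc x hx y hy]
      exact nextArc_base_base
    · rw [hgA x hx, hgD y hy]
      exact iff_of_false not_nextArc_base_copy (harcAD x hx y hy).1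
    · rw [hgD x hx, hgA y hy]
      exact iff_of_false not_nextArc_copy_base (harcAD y hy x hx).2
    · rw [hgD x hx, hgD y hy, ← harc' x hx y hy]
      exact nextArc_copy_copy
  · rintro T (⟨hT, hTD⟩ | ⟨hTA, T₁, hT₁, hTD⟩)
    · obtain ⟨T', hT', hiff⟩ := hset T hT
      refine ⟨_, ⟨⟨T', hT'⟩, ⟨T', hT'⟩, Or.inr rfl⟩, ?_⟩
      rintro x (hx | hx)
      · rw [hgA x hx]
        exact base_mem_union_new.trans (hiff x hx)
      · rw [hgD x hx]
        exact iff_of_false copy_notMem_union_new (hTD.notMem_of_mem_right hx)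
    · obtain ⟨T', hT', hiff⟩ := hset' T₁ hT₁
      refine ⟨_, ⟨Q, ⟨T', hT'⟩, Or.inl rfl⟩, ?_⟩
      rintro x (hx | hx)
      · have h1 := Set.ext_iff.1 hTA x
        simp only [Set.mem_inter_iff, hx, and_true] at h1
        rw [hgA x hx, h1]
        exact base_mem_union_copy.trans (hPiff x hx)
      · have h1 := Set.ext_iff.1 hTD x
        simp only [Set.mem_inter_iff, hx, and_true] at h1
        rw [hgD x hx, h1]
        exact copy_mem_union_copy.trans (hiff x hx)

theorem mono (h : X.Realizes arc A 𝒯) {A' : Set S} {𝒯' : Set (Set S)} (hA : A' ⊆ A)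
    (h𝒯 : 𝒯' ⊆ 𝒯) : X.Realizes arc A' 𝒯' := by
  obtain ⟨f, hinj, harc, hset⟩ := h
  refine ⟨f, hinj.mono hA, fun x hx y hy => harc x (hA hx) y (hA hy), fun T hT => ?_⟩
  obtain ⟨T', hT', hiff⟩ := hset T (h𝒯 hT)
  exact ⟨T', hT', fun x hx => hiff x (hA hx)⟩

theorem burlingSequence_le {k l : ℕ} (h : (burlingSequence k).Realizes arc A 𝒯) (hkl : k ≤ l) :
    (burlingSequence l).Realizes arc A 𝒯 := by
  induction hkl with
  | refl => exact h
  | step _ ih => exact ih.next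

end GraphWithSets.Realizes

/-- The upward closed chains of `A` with respect to `prec`. -/
def upperChains {S : Type*} (prec : S → S → Prop) (A : Set S) : Set (Set S) :=
  {T | T ⊆ A ∧ (∀ x ∈ T, ∀ y ∈ A, prec x y → y ∈ T) ∧
    ∀ x ∈ T, ∀ y ∈ T, x ≠ y → prec x y ∨ prec y x}

/-! ### Finite Burling sets in the Burling sequence. -/

namespace IsBurlingSet

variable {S : Type*} {prec arc : S → S → Prop}

/-- A non-empty finite subset has an element that is maximal and has no in-neighbour. -/
theorem exists_maximal_source (h : IsBurlingSet prec arc) (A : Finset S) (hA : A.Nonempty) :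
    ∃ v ∈ A, (∀ x ∈ A, ¬ prec v x) ∧ ∀ x ∈ A, ¬ arc x v := by
  classical
  have : IsTrans S prec := ⟨h.prec_trans⟩
  have : Std.Irrefl prec := ⟨h.prec_irrefl⟩
  have : IsStrictOrder S prec := {}
  have : Std.Irrefl (Relation.TransGen arc) := ⟨h.arc_acyclic⟩
  have : IsStrictOrder S (Relation.TransGen arc) := {}
  have key : ∀ (r : S → S → Prop) [IsStrictOrder S r] (B : Finset S), B.Nonempty →
      ∃ v ∈ B, ∀ x ∈ B, ¬ r x v := by
    intro r _ B hB
    obtain ⟨v, hv, hmin⟩ := (Set.wellFoundedOn_iff.1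
      (B.finite_toSet.wellFoundedOn (r := r))).has_min B hB
    exact ⟨v, hv, fun x hx hxv => hmin x hx ⟨hxv, hx, hv⟩⟩
  obtain ⟨m, hm, hmax⟩ := key (fun x y => prec y x) A hA
  -- It suffices to find a source among the maximal elements: by (A3), an in-neighbour of a maximal
  -- element is maximal.
  obtain ⟨v, hv, hsrc⟩ := key (Relation.TransGen arc) {x ∈ A | ∀ y ∈ A, ¬ prec x y}
    ⟨m, Finset.mem_filter.2 ⟨hm, hmax⟩⟩
  rw [Finset.mem_filter] at hv
  refine ⟨v, hv.1, hv.2, fun x hx hxv => ?_⟩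
  exact hsrc x (Finset.mem_filter.2 ⟨hx, fun y hy hxy => hv.2 y hy (h.a3 x v y hxv hxy)⟩)
    (.single hxv)

/-- Every finite subset of a Burling set is realized, with all its upward closed chains, in the
Burling sequence. -/
theorem exists_realizes (h : IsBurlingSet prec arc) (A : Finset S) :
    ∃ k, (burlingSequence k).Realizes arc A (upperChains prec A) := by
  classical
  induction A using Finset.strongInduction with
  | H A ih =>
  rcases A.eq_empty_or_nonempty with rfl | hA
  · exact ⟨0, fun _ => (), by simp [Set.InjOn], by simp, fun T _ => ⟨Set.univ, rfl, by simp⟩⟩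
  obtain ⟨v, hvA, hmax, hsrc⟩ := h.exists_maximal_source A hA
  let D : Finset S := {x ∈ A | prec x v}
  let B : Finset S := {x ∈ A | x ≠ v ∧ ¬ prec x v}
  have hD : ∀ x, x ∈ D ↔ x ∈ A ∧ prec x v := fun x => Finset.mem_filter
  have hB : ∀ x, x ∈ B ↔ x ∈ A ∧ x ≠ v ∧ ¬ prec x v := fun x => Finset.mem_filter
  have hvD : v ∉ D := fun hv => h.prec_irrefl v ((hD v).1 hv).2
  have hvB : v ∉ B := fun hv => ((hB v).1 hv).2.1 rfl
  obtain ⟨k₁, h₁⟩ := ih D ((Finset.ssubset_iff_of_subset (Finset.filter_subset _ _)).2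
    ⟨v, hvA, hvD⟩)
  obtain ⟨k₂, h₂⟩ := ih B ((Finset.ssubset_iff_of_subset (Finset.filter_subset _ _)).2
    ⟨v, hvA, hvB⟩)
  have hloop : ¬ arc v v := hsrc v hvA
  -- the out-neighbours of `v` form an upward closed chain outside the down-set of `v`
  have hN : {x | x ∈ A ∧ arc v x} ∈ upperChains prec (B : Set S) := by
    refine ⟨?_, ?_, ?_⟩
    · rintro x ⟨hx, hvx⟩
      refine (hB x).2 ⟨hx, by rintro rfl; exact hloop hvx, fun hxv => ?_⟩
      rcases h.a4 v x v hvx hxv with h' | h'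
      · exact hloop h'
      · exact h.prec_irrefl v h'
    · rintro x ⟨hx, hvx⟩ y hy hxy
      have hyA := ((hB y).1 hy).1
      exact ⟨hyA, (h.a4 v x y hvx hxy).resolve_right (hmax y hyA)⟩
    · rintro x ⟨_, hvx⟩ y ⟨_, hvy⟩ hne
      exact h.a2 v x y hvx hvy hne
  have hv₂ := (h₂.burlingSequence_le (le_max_right k₁ k₂)).next_insert (v := v) hvB hN
    (fun x hx => ⟨fun hvx => ⟨((hB x).1 hx).1, hvx⟩, fun hx => hx.2⟩)
    (by
      rintro x (rfl | hx)
      · exact hloop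
      · exact hsrc x ((hB x).1 hx).1)
  -- This extra step matches the index reached when `v` was added to `B`.
  have hv₁ := (h₁.burlingSequence_le (le_max_left k₁ k₂)).next
  have hdisj : Disjoint (insert v (B : Set S)) (D : Set S) := by
    rw [Set.disjoint_left]
    rintro x (rfl | hx) hxD
    · exact hvD hxD
    · exact ((hB x).1 hx).2.2 ((hD x).1 hxD).2
  have hno : ∀ x ∈ insert v (B : Set S), ∀ y ∈ (D : Set S), ¬ arc x y ∧ ¬ arc y x := by
    intro x hx y hy
    have hyv := ((hD y).1 hy).2
    have hxA : x ∈ A := by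
      rcases hx with rfl | hx
      · exact hvA
      · exact ((hB x).1 hx).1
    have hxv : ¬ prec x v := by
      rcases hx with rfl | hx
      · exact h.prec_irrefl _
      · exact ((hB x).1 hx).2.2
    -- As `y ≺ v`, an arc in either direction would give `x ↷ v` or `x ≺ v`.
    exact ⟨fun hxy => (h.a4 x y v hxy hyv).elim (hsrc x hxA) hxv,
      fun hyx => hxv (h.a3 y x v hyx hyv)⟩
  refine ⟨max k₁ k₂ + 1 + 1, (hv₂.next_union hv₁ hdisj hno (Set.mem_insert _ _)).mono ?_ ?_⟩
  · intro x hx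
    by_cases hxv : x = v
    · exact Or.inl (Or.inl hxv)
    by_cases hxv' : prec x v
    · exact Or.inr ((hD x).2 ⟨hx, hxv'⟩)
    · exact Or.inl (Or.inr ((hB x).2 ⟨hx, hxv, hxv'⟩))
  · rintro T ⟨hTA, hTup, hTch⟩
    -- A chain through the maximal element `v` is `v` together with an upward closed chain of `D`;
    -- one avoiding `v` also avoids `D`, by upward closure.
    by_cases hvT : v ∈ T
    · have hbelow : ∀ x ∈ T, x ≠ v → prec x v := fun x hx hne =>
        (hTch x hx v hvT hne).resolve_right (hmax x (hTA hx))
      refine Or.inr ⟨?_, T ∩ D, ⟨Set.inter_subset_right, ?_, ?_⟩, ?_⟩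
      · ext x
        refine ⟨fun ⟨hx, hx'⟩ => ⟨?_, hx'⟩, fun ⟨hx, hx'⟩ => ⟨?_, hx'⟩⟩
        · rcases hx' with rfl | hxB
          · rfl
          · exact absurd (hbelow x hx ((hB x).1 hxB).2.1) ((hB x).1 hxB).2.2
        · rw [Set.mem_singleton_iff.1 hx]
          exact hvT
      · rintro x ⟨hx, _⟩ y hy hxy
        exact ⟨hTup x hx y ((hD y).1 hy).1 hxy, hy⟩
      · rintro x ⟨hx, _⟩ y ⟨hy, _⟩ hne
        exact hTch x hx y hy hne
      · rw [Set.inter_assoc, Set.inter_self]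
    · have hTv : ∀ x ∈ T, ¬ prec x v := fun x hx hxv => hvT (hTup x hx v hvA hxv)
      refine Or.inl ⟨Or.inr ⟨⟨fun x hx => (hB x).2 ⟨hTA hx, ?_, hTv x hx⟩, ?_, hTch⟩, hvT⟩, ?_⟩
      · rintro rfl
        exact hvT hx
      · exact fun x hx y hy hxy => hTup x hx y ((hB y).1 hy).1 hxy
      · rw [Set.disjoint_left]
        exact fun x hx hxD => hTv x hx ((hD x).1 hxD).2

theorem comap {V : Type*} {arc' : V → V → Prop} (h : IsBurlingSet prec arc)
    (e : arc' ≃r arc) : IsBurlingSet (fun x y => prec (e x) (e y)) arc' where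
  nonempty := h.nonempty.map e.symm
  prec_irrefl _ := h.prec_irrefl _
  prec_trans _ _ _ := h.prec_trans _ _ _
  arc_acyclic x hx := h.arc_acyclic (e x) (hx.lift e fun _ _ hab => e.map_rel_iff.2 hab)
  a1 _ _ _ h1 h2 hne := h.a1 _ _ _ h1 h2 (e.injective.ne hne)
  a2 _ _ _ h1 h2 hne :=
    h.a2 _ _ _ (e.map_rel_iff.2 h1) (e.map_rel_iff.2 h2) (e.injective.ne hne)
  a3 _ _ _ h1 h2 := h.a3 _ _ _ (e.map_rel_iff.2 h1) h2
  a4 _ _ _ h1 h2 := (h.a4 _ _ _ (e.map_rel_iff.2 h1) h2).imp_left e.map_rel_iff.1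

end IsBurlingSet

/-- Finite oriented abstract Burling graphs are oriented Burling graphs. -/
theorem IsOrientedAbstractBurlingGraph.isOrientedBurlingGraph {V : Type*} [Finite V]
    {G : Digraph V} (h : IsOrientedAbstractBurlingGraph G) : IsOrientedBurlingGraph G := by
  cases nonempty_fintype V
  obtain ⟨prec, h⟩ := h
  obtain ⟨k, f, hinj, harc, -⟩ := h.exists_realizes Finset.univ
  exact ⟨k, ⟨⟨⟨f, fun x y => hinj (by simp) (by simp)⟩,
    fun {x y} => harc x (by simp) y (by simp)⟩⟩⟩

theorem IsOrientedBurlingGraph.isBurlingGraph {V : Type*} {G : Digraph V}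
    (h : IsOrientedBurlingGraph G) : IsBurlingGraph G.toSimpleGraphInclusive := by
  obtain ⟨k, ⟨f⟩⟩ := h
  refine ⟨k, ⟨⟨f.toEmbedding, fun {x y} => ?_⟩⟩⟩
  simp [Digraph.toSimpleGraphInclusive, f.map_rel_iff]

theorem theorem4p4 :
    (∀ F : Set (Set (ℝ × ℝ)), IsConstrainedFamily F →
      IsBurlingSet (fun A B : F => PounaPrec A.1 B.1) (fun A B : F => PounaArc A.1 B.1)) ∧
    (∀ (V : Type*) (G : Digraph V), IsOrientedConstrainedGraph G →
      IsOrientedAbstractBurlingGraph G ∧ IsOrientedBurlingGraph G ∧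
        IsBurlingGraph G.toSimpleGraphInclusive) := by
  refine ⟨fun F hF => hF.isBurlingSet, ?_⟩
  rintro V G ⟨F, hF, ⟨e⟩⟩
  have : Finite F := hF.finite
  have : Finite V := Finite.of_equiv F e.toEquiv.symm
  have h : IsOrientedAbstractBurlingGraph G := ⟨_, hF.isBurlingSet.comap e⟩
  exact ⟨h, h.isOrientedBurlingGraph, h.isOrientedBurlingGraph.isBurlingGraph⟩
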